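/- For complex numbers $a\neq 0$ and $c$ let $H_{a,c}\colon\mathbb{C}^2\to\mathbb{C}^2$, $H_{a,c}(x,y)=(x^2+c-ay,\,x)$, be the complex Hénon map. Let $K^{+}$ (respectively $K^{-}$) be the set of points of $\mathbb{C}^2$ whose forward orbit under $H_{a,c}$ (respectively under $H_{a,c}^{-1}$) is bounded, let $J^{\pm}=\partial K^{\pm}$ be their topological boundaries, and let $J=J^{+}\cap J^{-}$ be the Julia set of $H_{a,c}$. The map $f=H_{a,c}$ is called hyperbolic if $J$ is a hyperbolic set for $f$; that is, $J$ is compact with $f(J)=J$, and at each $x\in J$ there is a splitting $T_x\mathbb{C}^2=E^s_x\oplus E^u_x$ into complex subspaces, varying continuously with $x\in J$, such that 1. $D_xf(E^s_x)=E^s_{f(x)}$ and $D_xf(E^u_x)=E^u_{f(x)}$ for every $x\in J$; 2. there are a constant $\lambda>1$ and a family of norms $\|\cdot\|_x$ on $T_x\mathbb{C}^2$, continuous in $x\in J$, such that for every $x\in J$ $$\|D_xf(w)\|_{f(x)}\ \ge\ \lambda\|w\|_x\quad (w\in E^u_x),\qquad \|D_xf^{-1}(w)\|_{f^{-1}(x)}\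 \ge\ \lambda\|w\|_x\quad (w\in E^s_x).$$ Theorem. The complex Hénon maps $H_{a,c}$ with $$(c,a)=(-0.3,\,0.1),\quad (0,\,-0.22),\quad (-3,\,-0.25),\quad (1.5,\,0.5)$$ are hyperbolic. -/

import Mathlib

section Hyperbolic

variable {𝕜 : Type*} [RCLike 𝕜] {V : Type*} [NormedAddCommGroup V] [NormedSpace 𝕜 V]

/-- The family of subspaces `Es x`, `Eu x` of the tangent space `T_x V = V`, `x ∈ Λ`, is a splitting
`T_x V = Es x ⊕ Eu x` that varies continuously with `x ∈ Λ`: the projections onto `Es x` along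
`Eu x` are a continuous family of operators. -/
def IsContinuousSplittingOn (Es Eu : V → Submodule 𝕜 V) (Λ : Set V) : Prop :=
  (∀ x ∈ Λ, IsCompl (Es x) (Eu x)) ∧
    ∃ P : V → V →L[𝕜] V, ContinuousOn P Λ ∧
      ∀ x ∈ Λ, (∀ v ∈ Es x, P x v = v) ∧ (∀ v ∈ Eu x, P x v = 0)

/-- The family `N x`, `x ∈ Λ`, is a continuous family of norms on the tangent spaces
`T_x V = V`, `x ∈ Λ`. -/
def IsContinuousNormOn (N : V → Seminorm 𝕜 V) (Λ : Set V) : Prop :=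
  (∀ x ∈ Λ, ∀ v : V, N x v = 0 → v = 0) ∧
    ContinuousOn (fun p : V × V => N p.1 p.2) (Λ ×ˢ Set.univ)

/-- `Λ` is a (compact, invariant) hyperbolic set for the diffeomorphism `f` of `V`: there is a
continuous invariant splitting of the tangent bundle over `Λ` such that, in some continuous norm on
the tangent bundle over `Λ`, `Df` expands `Eu` uniformly and `Df⁻¹` expands `Es` uniformly.
The derivatives, the subspaces and the norms are over `𝕜`. -/
structure IsHyperbolicSet (𝕜 : Type*) [RCLike 𝕜] {V : Type*} [NormedAddCommGroup V]
    [NormedSpace 𝕜 V] (f : V ≃ V) (Λ : Set V) : Prop where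
  contDiff : ContDiff 𝕜 1 f
  contDiff_symm : ContDiff 𝕜 1 f.symm
  isCompact : IsCompact Λ
  image_eq : f '' Λ = Λ
  exists_splitting : ∃ Es Eu : V → Submodule 𝕜 V,
    IsContinuousSplittingOn Es Eu Λ ∧
    (∀ x ∈ Λ, (fderiv 𝕜 f x) '' (Es x : Set V) = (Es (f x) : Set V) ∧
      (fderiv 𝕜 f x) '' (Eu x : Set V) = (Eu (f x) : Set V)) ∧
    ∃ (lam : ℝ) (N : V → Seminorm 𝕜 V), 1 < lam ∧ IsContinuousNormOn N Λ ∧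
      ∀ x ∈ Λ,
        (∀ w ∈ Eu x, lam * N x w ≤ N (f x) (fderiv 𝕜 f x w)) ∧
        (∀ w ∈ Es x, lam * N x w ≤ N (f.symm x) (fderiv 𝕜 f.symm x w))

end Hyperbolic

section Julia

variable {V : Type*} [NormedAddCommGroup V]

/-- `K⁺(g)`: the points with bounded forward orbit under `g`. The set `K⁻` of a bijection `f` is
`boundedOrbitSet f.symm`. -/
def boundedOrbitSet (g : V → V) : Set V :=
  {p | Bornology.IsBounded (Set.range fun n : ℕ => g^[n] p)}

/-- The Julia set `J = J⁺ ∩ J⁻`, where `J⁺` and `J⁻` are the topological boundaries of `K⁺`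
and `K⁻`. -/
def juliaSet (f : V ≃ V) : Set V :=
  frontier (boundedOrbitSet f) ∩ frontier (boundedOrbitSet f.symm)

end Julia

/-- The complex Hénon map `H_{a,c}(x, y) = (x² + c - a y, x)`, `a ≠ 0`, as a bijection of `ℂ²`. -/
noncomputable def henon (a c : ℂ) (ha : a ≠ 0) : ℂ × ℂ ≃ ℂ × ℂ where
  toFun p := (p.1 ^ 2 + c - a * p.2, p.1)
  invFun p := (p.2, (p.2 ^ 2 + c - p.1) / a)
  left_inv p := by
    ext
    · rfl
    · show (p.1 ^ 2 + c - (p.1 ^ 2 + c - a * p.2)) / a = p.2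
      field_simp
      ring
  right_inv p := by
    ext
    · show p.2 ^ 2 + c - a * ((p.2 ^ 2 + c - p.1) / a) = p.1
      field_simp
      ring
    · rfl

/-- The Hénon map `H_{a,c}` is hyperbolic: `a ≠ 0` (so that `H_{a,c}` is a diffeomorphism of `ℂ²`)
and the Julia set of `H_{a,c}` is a hyperbolic set for `H_{a,c}`. -/
def HenonIsHyperbolic (a c : ℂ) : Prop :=
  ∃ ha : a ≠ 0, IsHyperbolicSet ℂ (henon a c ha) (juliaSet (henon a c ha))

/-! Along an orbit `x_n` the derivative acts by `u_{n+1} = 2 x_n u_n - a u_{n-1}`. Suppose a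
positive weight satisfies `θ(x_{n+1}) + |a| θ(x_{n-1}) < 2 |x_n| θ(x_n)` on `J`, so that this
recursion is diagonally dominant. Then the slope `u_{n-1} / u_n` of an unstable line, and after it a
complementary stable line, are fixed points of contractions on spaces of continuous functions on
`J`, and `θ` rescales the frame to an adapted norm (`isHyperbolicSet_henon`).

It remains to locate `J` and choose `θ`. The filtration puts `J` in a bidisk
(`norm_le_of_mem_juliaSet`), and dominance can then fail only near `x_n = 0`. For `a = 0.1` and `a =
-0.22` the points with small `x_n` lie in the interior of `K⁺`, and `θ = 1` works. For the other two
maps the relation `x_{n+1} + a x_{n-1} = x_n² + c` keeps `x_n` away from `0`, but not far enough for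
`θ = 1`. The same relation shows which weight helps: if `x_n` is small, then `x_{n±1}` are pushed to
where `θ` is small. -/

/-! ### Invariant line fields of a diagonally dominant cocycle -/

/-- A solution `q` of the Riccati equation of the cocycle `u_{n+1} = 2 ξ_n u_n - a u_{n-1}`, under
weighted diagonal dominance. -/
theorem exists_unstable_slope {X : Type*} [TopologicalSpace X] [CompactSpace X] (F : X ≃ₜ X)
    (ξ : C(X, ℂ)) (θ : C(X, ℝ)) (a : ℂ) (κ : ℝ) (hθ : ∀ p, 0 < θ p) (hκ : 0 < κ)
    (haκ : ‖a‖ * κ ^ 2 < 1)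
    (hdom : ∀ p, κ⁻¹ * θ (F p) + ‖a‖ * κ * θ (F.symm p) ≤ 2 * ‖ξ p‖ * θ p) :
    ∃ q : C(X, ℂ), ∀ p, q (F p) * (2 * ξ p - a * q p) = 1 ∧ ‖q (F p)‖ * θ (F p) ≤ κ * θ p := by
  -- The unknown is `Q = θ² q`. In this variable the Riccati map has sup-norm Lipschitz constant
  -- `|a| κ²`; for `q` itself, ratios of values of `θ` would remain. Membership in `S` is the slope
  -- bound `|q(p)| θ(p) ≤ κ θ(F⁻¹ p)`.
  let S : Set C(X, ℂ) := {Q | ∀ p, ‖Q p‖ ≤ κ * θ p * θ (F.symm p)}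
  have hS : IsClosed S := by
    have : S = ⋂ p, {Q : C(X, ℂ) | ‖Q p‖ ≤ κ * θ p * θ (F.symm p)} := by
      ext Q; simp [S]
    rw [this]
    exact isClosed_iInter fun p =>
      isClosed_le (continuous_norm.comp (continuous_eval_const p)) continuous_const
  have hSc : CompleteSpace S := hS.completeSpace_coe
  have hne : Nonempty S := ⟨⟨0, fun p => by
    have := hθ p; have := hθ (F.symm p); simp only [ContinuousMap.zero_apply, norm_zero]
    positivity⟩⟩
  have hden : ∀ Q ∈ S, ∀ p, θ (F p) ≤ ‖2 * ξ p - a * (Q p / (θ p : ℂ) ^ 2)‖ * (κ * θ p) := by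
    intro Q hQ p
    have h1 := hθ p
    have h2 : ‖a * (Q p / (θ p : ℂ) ^ 2)‖ * θ p ≤ ‖a‖ * κ * θ (F.symm p) := by
      have := hQ p
      rw [norm_mul, norm_div, norm_pow, Complex.norm_real, Real.norm_of_nonneg h1.le]
      have e : ‖a‖ * (‖Q p‖ / θ p ^ 2) * θ p = ‖a‖ * (‖Q p‖ / θ p) := by field_simp
      rw [e, mul_assoc]
      refine mul_le_mul_of_nonneg_left ?_ (norm_nonneg a)
      rw [div_le_iff₀ h1]
      linarith
    have h3 : 2 * ‖ξ p‖ - ‖a * (Q p / (θ p : ℂ) ^ 2)‖ ≤ ‖2 * ξ p - a * (Q p / (θ p : ℂ) ^ 2)‖ := by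
      have := norm_sub_norm_le (2 * ξ p) (a * (Q p / (θ p : ℂ) ^ 2))
      rwa [norm_mul, Complex.norm_ofNat] at this
    have h4 := hdom p
    have h5 : κ⁻¹ * θ (F p) ≤ ‖2 * ξ p - a * (Q p / (θ p : ℂ) ^ 2)‖ * θ p := by
      nlinarith [mul_le_mul_of_nonneg_right h3 h1.le]
    calc θ (F p) = κ * (κ⁻¹ * θ (F p)) := by field_simp
      _ ≤ κ * (‖2 * ξ p - a * (Q p / (θ p : ℂ) ^ 2)‖ * θ p) := by gcongr
      _ = _ := by ring
  have hden0 : ∀ Q ∈ S, ∀ p, 2 * ξ p - a * (Q p / (θ p : ℂ) ^ 2) ≠ 0 := by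
    intro Q hQ p h0
    have := hden Q hQ p
    rw [h0, norm_zero, zero_mul] at this
    exact absurd this (not_le.2 (hθ _))
  have hθ0 : ∀ p, (θ p : ℂ) ≠ 0 := fun p => by exact_mod_cast (hθ p).ne'
  let T : S → S := fun Q =>
    ⟨⟨fun p => (θ p : ℂ) ^ 2 /
        (2 * ξ (F.symm p) - a * (Q.1 (F.symm p) / (θ (F.symm p) : ℂ) ^ 2)), by
      refine Continuous.div (by fun_prop) ?_ fun p => hden0 Q.1 Q.2 _
      refine Continuous.sub (by fun_prop) (continuous_const.mul ?_)
      exact Continuous.div (by fun_prop) (by fun_prop) fun p => pow_ne_zero 2 (hθ0 _)⟩, by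
      intro p
      have h := hden Q.1 Q.2 (F.symm p)
      have h1 := hθ p
      rw [F.apply_symm_apply] at h
      simp only [ContinuousMap.coe_mk, norm_div, norm_pow, Complex.norm_real,
        Real.norm_of_nonneg h1.le]
      rw [div_le_iff₀ (norm_pos_iff.2 (hden0 Q.1 Q.2 _))]
      nlinarith⟩
  have hT : ∀ (Q : S) (p), (T Q).1 (F p) =
      (θ (F p) : ℂ) ^ 2 / (2 * ξ p - a * (Q.1 p / (θ p : ℂ) ^ 2)) := by
    intro Q p
    simp [T]
  have hlip : ∀ Q Q' : S, dist (T Q) (T Q') ≤ ‖a‖ * κ ^ 2 * dist Q Q' := by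
    intro Q Q'
    rw [Subtype.dist_eq, ContinuousMap.dist_le (by positivity)]
    intro p
    obtain ⟨p, rfl⟩ := F.surjective p
    rw [hT, hT, dist_eq_norm]
    set A := 2 * ξ p - a * (Q.1 p / (θ p : ℂ) ^ 2) with hA
    set B := 2 * ξ p - a * (Q'.1 p / (θ p : ℂ) ^ 2) with hB
    have hA0 : A ≠ 0 := hden0 Q.1 Q.2 p
    have hB0 : B ≠ 0 := hden0 Q'.1 Q'.2 p
    have hA1 : θ (F p) ≤ ‖A‖ * (κ * θ p) := hden Q.1 Q.2 p
    have hB1 : θ (F p) ≤ ‖B‖ * (κ * θ p) := hden Q'.1 Q'.2 p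
    have hd : ‖Q.1 p - Q'.1 p‖ ≤ dist Q Q' := by
      rw [← dist_eq_norm, Subtype.dist_eq]
      exact ContinuousMap.dist_apply_le_dist p
    have e : (θ (F p) : ℂ) ^ 2 / A - (θ (F p) : ℂ) ^ 2 / B =
        (θ (F p) : ℂ) ^ 2 * (a * (Q.1 p - Q'.1 p)) / (A * B * (θ p : ℂ) ^ 2) := by
      have : a * (Q.1 p - Q'.1 p) = (B - A) * (θ p : ℂ) ^ 2 := by
        rw [hA, hB]
        have := hθ0 p
        field_simp
        ring
      rw [this]
      have := hθ0 p
      field_simp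
    have h1 := hθ p
    have h2 := hθ (F p)
    rw [e]
    simp only [norm_div, norm_mul, norm_pow, Complex.norm_real, Real.norm_of_nonneg h1.le,
      Real.norm_of_nonneg h2.le]
    rw [div_le_iff₀ (by positivity)]
    have h3 : θ (F p) ^ 2 ≤ ‖A‖ * (κ * θ p) * (‖B‖ * (κ * θ p)) := by
      rw [sq]; exact mul_le_mul hA1 hB1 h2.le (h2.le.trans hA1)
    calc θ (F p) ^ 2 * (‖a‖ * ‖Q.1 p - Q'.1 p‖)
        ≤ (‖A‖ * (κ * θ p) * (‖B‖ * (κ * θ p))) * (‖a‖ * dist Q Q') := by gcongr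
      _ = _ := by ring
  have hc : ContractingWith ⟨‖a‖ * κ ^ 2, by positivity⟩ T :=
    ⟨by exact_mod_cast haκ, LipschitzWith.of_dist_le_mul hlip⟩
  obtain ⟨Q, hQ⟩ : ∃ Q, T Q = Q := ⟨_, hc.fixedPoint_isFixedPt⟩
  refine ⟨⟨fun p => Q.1 p / (θ p : ℂ) ^ 2,
    Continuous.div (by fun_prop) (by fun_prop) fun p => pow_ne_zero 2 (hθ0 _)⟩, fun p => ?_⟩
  have h1 := hT Q p
  rw [hQ] at h1
  have h2 := hden Q.1 Q.2 p
  have h0 := hden0 Q.1 Q.2 p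
  have h3 := hθ (F p)
  simp only [ContinuousMap.coe_mk, h1]
  set A := 2 * ξ p - a * (Q.1 p / (θ p : ℂ) ^ 2)
  have h4 := hθ0 (F p)
  refine ⟨by field_simp, ?_⟩
  have e : (θ (F p) : ℂ) ^ 2 / A / (θ (F p) : ℂ) ^ 2 = 1 / A := by field_simp
  rw [e, norm_div, norm_one, div_mul_eq_mul_div, one_mul, div_le_iff₀ (norm_pos_iff.2 h0)]
  linarith

/-- The linear equation for the stable direction in the frame given by the unstable slope `q`. -/
theorem exists_stable_coefficient {X : Type*} [TopologicalSpace X] [CompactSpace X] (F : X ≃ₜ X)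
    (q : C(X, ℂ)) (θ : C(X, ℝ)) (a : ℂ) (κ : ℝ) (hθ : ∀ p, 0 < θ p) (hκ : 0 < κ)
    (haκ : ‖a‖ * κ ^ 2 < 1) (hq : ∀ p, ‖q (F p)‖ * θ (F p) ≤ κ * θ p) :
    ∃ h : C(X, ℂ), ∀ p, h p = a * q (F p) * (1 + q (F p) * h (F p)) := by
  have hθ0 : ∀ p, (θ p : ℂ) ≠ 0 := fun p => by exact_mod_cast (hθ p).ne'
  -- Here the unknown is `H = h / θ²`. The equation is affine with coefficient `a (q(F p) θ(F p) /
  -- θ(p))²`, of modulus at most `|a| κ²`, so no invariant ball is needed.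
  let T : C(X, ℂ) → C(X, ℂ) := fun H =>
    ⟨fun p => a * q (F p) * (1 + q (F p) * ((θ (F p) : ℂ) ^ 2 * H (F p))) / (θ p : ℂ) ^ 2,
      Continuous.div (by fun_prop) (by fun_prop) fun p => pow_ne_zero 2 (hθ0 _)⟩
  have hlip : ∀ H H' : C(X, ℂ), dist (T H) (T H') ≤ ‖a‖ * κ ^ 2 * dist H H' := by
    intro H H'
    rw [ContinuousMap.dist_le (by positivity)]
    intro p
    have hd : ‖H (F p) - H' (F p)‖ ≤ dist H H' := by
      rw [← dist_eq_norm]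
      exact ContinuousMap.dist_apply_le_dist _
    have e : T H p - T H' p =
        a * (q (F p) * (θ (F p) : ℂ)) ^ 2 * (H (F p) - H' (F p)) / (θ p : ℂ) ^ 2 := by
      simp only [T, ContinuousMap.coe_mk]
      ring
    have h1 := hθ p
    have h2 := hθ (F p)
    rw [dist_eq_norm, e]
    simp only [norm_div, norm_mul, norm_pow, Complex.norm_real, Real.norm_of_nonneg h1.le,
      Real.norm_of_nonneg h2.le]
    rw [div_le_iff₀ (by positivity)]
    calc ‖a‖ * (‖q (F p)‖ * θ (F p)) ^ 2 * ‖H (F p) - H' (F p)‖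
        ≤ ‖a‖ * (κ * θ p) ^ 2 * dist H H' :=
          mul_le_mul (mul_le_mul_of_nonneg_left (pow_le_pow_left₀ (by positivity) (hq p) 2)
            (norm_nonneg a)) hd (norm_nonneg _) (by positivity)
      _ = _ := by ring
  have hc : ContractingWith ⟨‖a‖ * κ ^ 2, by positivity⟩ T :=
    ⟨by exact_mod_cast haκ, LipschitzWith.of_dist_le_mul hlip⟩
  obtain ⟨H, hH⟩ : ∃ H, T H = H := ⟨_, hc.fixedPoint_isFixedPt⟩
  refine ⟨⟨fun p => (θ p : ℂ) ^ 2 * H p, by fun_prop⟩, fun p => ?_⟩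
  have h1 : H p = _ := (DFunLike.congr_fun hH p).symm
  simp only [ContinuousMap.coe_mk]
  rw [h1]
  simp only [T, ContinuousMap.coe_mk]
  have := hθ0 p
  field_simp

/-! ### Derivatives of the Hénon map -/

theorem image_span_singleton {𝕜 V W : Type*} [Field 𝕜] [AddCommGroup V] [Module 𝕜 V]
    [AddCommGroup W] [Module 𝕜 W] (L : V →ₗ[𝕜] W) {v : V} {w : W} {k : 𝕜} (hk : k ≠ 0)
    (h : L v = k • w) :
    L '' (Submodule.span 𝕜 {v} : Set V) = (Submodule.span 𝕜 {w} : Set W) := by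
  rw [← Submodule.map_coe, Submodule.map_span, Set.image_singleton, h,
    Submodule.span_singleton_smul_eq (IsUnit.mk0 k hk)]

theorem henon_apply (a c : ℂ) (ha : a ≠ 0) (p : ℂ × ℂ) :
    henon a c ha p = (p.1 ^ 2 + c - a * p.2, p.1) := rfl

theorem henon_symm_apply (a c : ℂ) (ha : a ≠ 0) (p : ℂ × ℂ) :
    (henon a c ha).symm p = (p.2, (p.2 ^ 2 + c - p.1) / a) := rfl

theorem contDiff_henon (a c : ℂ) (ha : a ≠ 0) : ContDiff ℂ 1 (henon a c ha) := by
  change ContDiff ℂ 1 fun p : ℂ × ℂ => (p.1 ^ 2 + c - a * p.2, p.1)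
  fun_prop

theorem contDiff_henon_symm (a c : ℂ) (ha : a ≠ 0) : ContDiff ℂ 1 (henon a c ha).symm := by
  change ContDiff ℂ 1 fun p : ℂ × ℂ => (p.2, (p.2 ^ 2 + c - p.1) / a)
  fun_prop

theorem fderiv_henon (a c : ℂ) (ha : a ≠ 0) (p w : ℂ × ℂ) :
    fderiv ℂ (henon a c ha) p w = (2 * p.1 * w.1 - a * w.2, w.1) := by
  have h1 : HasFDerivAt (fun p : ℂ × ℂ => p.1) (ContinuousLinearMap.fst ℂ ℂ ℂ) p := hasFDerivAt_fst
  have h2 : HasFDerivAt (fun p : ℂ × ℂ => p.2) (ContinuousLinearMap.snd ℂ ℂ ℂ) p := hasFDerivAt_snd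
  have h : HasFDerivAt (henon a c ha) _ p :=
    HasFDerivAt.prodMk (((h1.pow 2).add_const c).sub (h2.const_mul a)) h1
  rw [h.fderiv]
  simp

theorem fderiv_henon_symm (a c : ℂ) (ha : a ≠ 0) (p w : ℂ × ℂ) :
    fderiv ℂ (henon a c ha).symm p w = (w.2, (2 * p.2 * w.2 - w.1) / a) := by
  have h1 : HasFDerivAt (fun p : ℂ × ℂ => p.1) (ContinuousLinearMap.fst ℂ ℂ ℂ) p := hasFDerivAt_fst
  have h2 : HasFDerivAt (fun p : ℂ × ℂ => p.2) (ContinuousLinearMap.snd ℂ ℂ ℂ) p := hasFDerivAt_snd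
  have h : HasFDerivAt (fun p : ℂ × ℂ => (p.2, (p.2 ^ 2 + c - p.1) * a⁻¹)) _ p :=
    HasFDerivAt.prodMk h2 ((((h2.pow 2).add_const c).sub h1).mul_const a⁻¹)
  have e : ⇑(henon a c ha).symm = fun p : ℂ × ℂ => (p.2, (p.2 ^ 2 + c - p.1) * a⁻¹) := by
    funext p
    rw [henon_symm_apply, div_eq_mul_inv]
  rw [e, h.fderiv]
  simp [div_eq_inv_mul]

/-- A continuous function on a subset, extended by zero. -/
noncomputable def zeroExtend {V : Type*} [TopologicalSpace V] {Λ : Set V} (q : C(Λ, ℂ)) : V → ℂ :=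
  open scoped Classical in fun p => if hp : p ∈ Λ then q ⟨p, hp⟩ else 0

theorem zeroExtend_of_mem {V : Type*} [TopologicalSpace V] {Λ : Set V} (q : C(Λ, ℂ)) {p : V}
    (hp : p ∈ Λ) : zeroExtend q p = q ⟨p, hp⟩ := by
  simp [zeroExtend, hp]

theorem continuousOn_zeroExtend {V : Type*} [TopologicalSpace V] {Λ : Set V} (q : C(Λ, ℂ)) :
    ContinuousOn (zeroExtend q) Λ := by
  rw [continuousOn_iff_continuous_domRestrict]
  convert q.continuous using 1
  funext p
  simp [zeroExtend]

/-! ### The frame `(1, q)`, `(h, 1 + h q)` -/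

section Frame

/-- The coefficient of `(h, 1 + h q)` of a vector in the basis `(1, q)`, `(h, 1 + h q)` of `ℂ²`. -/
noncomputable def stableCoord (q : ℂ) : ℂ × ℂ →ₗ[ℂ] ℂ :=
  LinearMap.snd ℂ ℂ ℂ - q • LinearMap.fst ℂ ℂ ℂ

/-- The coefficient of `(1, q)` of a vector in the basis `(1, q)`, `(h, 1 + h q)` of `ℂ²`. -/
noncomputable def unstableCoord (q h : ℂ) : ℂ × ℂ →ₗ[ℂ] ℂ :=
  LinearMap.fst ℂ ℂ ℂ - h • stableCoord q

theorem stableCoord_apply (q : ℂ) (w : ℂ × ℂ) : stableCoord q w = w.2 - q * w.1 := by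
  simp [stableCoord]

theorem unstableCoord_apply (q h : ℂ) (w : ℂ × ℂ) :
    unstableCoord q h w = w.1 - h * (w.2 - q * w.1) := by
  simp [unstableCoord, stableCoord]

/-- The norm with unit vectors `t • (1, q)` and `t⁻¹ • (h, 1 + h q)`. -/
noncomputable def frameNorm (q h : ℂ) (t : ℝ) : Seminorm ℂ (ℂ × ℂ) :=
  (normSeminorm ℂ ℂ).comp ((t : ℂ)⁻¹ • unstableCoord q h) +
    (normSeminorm ℂ ℂ).comp ((t : ℂ) • stableCoord q)

theorem frameNorm_apply (q h : ℂ) (t : ℝ) (w : ℂ × ℂ) :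
    frameNorm q h t w = ‖(t : ℂ)⁻¹ * (w.1 - h * (w.2 - q * w.1))‖ +
      ‖(t : ℂ) * (w.2 - q * w.1)‖ := by
  simp [frameNorm, unstableCoord_apply, stableCoord_apply]

theorem frameNorm_unstable (q h : ℂ) {t : ℝ} (ht : 0 < t) (α : ℂ) :
    frameNorm q h t (α • ((1 : ℂ), q)) = ‖α‖ / t := by
  have e : α * q - q * α = 0 := by ring
  simp [frameNorm_apply, e, abs_of_pos ht, div_eq_inv_mul]

theorem frameNorm_stable (q h : ℂ) {t : ℝ} (ht : 0 < t) (β : ℂ) :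
    frameNorm q h t (β • (h, 1 + h * q)) = ‖β‖ * t := by
  have e : β * (1 + h * q) - q * (β * h) = β := by ring
  rw [frameNorm_apply]
  simp only [Prod.smul_mk, smul_eq_mul]
  rw [e, mul_comm h β, sub_self, mul_zero, norm_zero, zero_add, norm_mul, Complex.norm_real,
    Real.norm_of_nonneg ht.le, mul_comm]

/-- The frame has determinant `1` for all `q` and `h`, so transversality needs no estimate. -/
theorem isCompl_frame (q h : ℂ) :
    IsCompl (Submodule.span ℂ {(h, 1 + h * q)}) (Submodule.span ℂ {((1 : ℂ), q)}) := by
  constructor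
  · rw [Submodule.disjoint_def]
    intro w hs hu
    obtain ⟨β, rfl⟩ := Submodule.mem_span_singleton.1 hs
    obtain ⟨α, hα⟩ := Submodule.mem_span_singleton.1 hu
    rw [Prod.ext_iff] at hα
    simp only [Prod.smul_mk, smul_eq_mul, mul_one] at hα
    have : β = 0 := by linear_combination q * hα.1 - hα.2
    rw [this, zero_smul]
  · rw [codisjoint_iff, eq_top_iff]
    intro w _
    refine Submodule.mem_sup.2 ⟨(w.2 - q * w.1) • (h, 1 + h * q),
      Submodule.smul_mem _ _ (Submodule.mem_span_singleton_self _),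
      (w.1 - h * (w.2 - q * w.1)) • ((1 : ℂ), q),
      Submodule.smul_mem _ _ (Submodule.mem_span_singleton_self _), ?_⟩
    ext <;> simp <;> ring

/-- The projection onto `ℂ (h, 1 + h q)` along `ℂ (1, q)`. -/
noncomputable def frameProj (q h : ℂ) : ℂ × ℂ →L[ℂ] ℂ × ℂ :=
  h • (ContinuousLinearMap.inl ℂ ℂ ℂ ∘L ContinuousLinearMap.snd ℂ ℂ ℂ) +
  (-(q * h)) • (ContinuousLinearMap.inl ℂ ℂ ℂ ∘L ContinuousLinearMap.fst ℂ ℂ ℂ) +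
  (1 + h * q) • (ContinuousLinearMap.inr ℂ ℂ ℂ ∘L ContinuousLinearMap.snd ℂ ℂ ℂ) +
  (-(q * (1 + h * q))) • (ContinuousLinearMap.inr ℂ ℂ ℂ ∘L ContinuousLinearMap.fst ℂ ℂ ℂ)

theorem frameProj_stable (q h β : ℂ) :
    frameProj q h (β • (h, 1 + h * q)) = β • (h, 1 + h * q) := by
  ext <;> simp [frameProj] <;> ring

theorem frameProj_unstable (q h α : ℂ) : frameProj q h (α • ((1 : ℂ), q)) = 0 := by
  ext <;> simp [frameProj] <;> ring

end Frame

/-! ### The hyperbolicity criterion -/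

/-- **Hyperbolicity from weighted diagonal dominance.** A compact invariant set of a Hénon map is
hyperbolic if the operator `u ↦ (u_{n+1} - 2 x_n u_n + a u_{n-1})_n` is diagonally dominant, in a
continuous weight, along all its orbits. -/
theorem isHyperbolicSet_henon {a c : ℂ} (ha : a ≠ 0) (ha1 : ‖a‖ < 1) {Λ : Set (ℂ × ℂ)}
    (hΛ : IsCompact Λ) (hinv : henon a c ha '' Λ = Λ) (θ : ℂ → ℝ) (hθc : Continuous θ)
    (hθ : ∀ p ∈ Λ, 0 < θ p.1)
    (hdom : ∀ p ∈ Λ, θ (p.1 ^ 2 + c - a * p.2) + ‖a‖ * θ p.2 < 2 * ‖p.1‖ * θ p.1) :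
    IsHyperbolicSet ℂ (henon a c ha) Λ := by
  have hf : ∀ p ∈ Λ, henon a c ha p ∈ Λ := fun p hp => hinv ▸ Set.mem_image_of_mem _ hp
  have hg : ∀ p ∈ Λ, (henon a c ha).symm p ∈ Λ := by
    intro p hp
    rw [← hinv] at hp
    obtain ⟨p, hp, rfl⟩ := hp
    rwa [Equiv.symm_apply_apply]
  have hθ1 : ∀ p ∈ Λ, 0 < θ (p.1 ^ 2 + c - a * p.2) := fun p hp => hθ _ (hf p hp)
  have hθ2 : ∀ p ∈ Λ, 0 < θ p.2 := fun p hp => hθ _ (hg p hp)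
  -- By compactness the strict dominance holds with a uniform factor: `κ` is the maximum over `Λ` of
  -- the ratio of the two sides.
  obtain ⟨κ, hκ0, hκ1, hκ⟩ : ∃ κ : ℝ, 0 < κ ∧ κ < 1 ∧ ∀ p ∈ Λ,
      θ (p.1 ^ 2 + c - a * p.2) + ‖a‖ * θ p.2 ≤ κ * (2 * ‖p.1‖ * θ p.1) := by
    rcases Λ.eq_empty_or_nonempty with rfl | hne
    · exact ⟨1 / 2, by norm_num, by norm_num, by simp⟩
    have hpos : ∀ p ∈ Λ, 0 < 2 * ‖p.1‖ * θ p.1 := fun p hp => by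
      have := hdom p hp; have := hθ1 p hp; have := hθ2 p hp
      have := mul_nonneg (norm_nonneg a) (hθ2 p hp).le
      linarith
    obtain ⟨p₀, hp₀, hmax⟩ := hΛ.exists_isMaxOn hne
      (f := fun p => (θ (p.1 ^ 2 + c - a * p.2) + ‖a‖ * θ p.2) / (2 * ‖p.1‖ * θ p.1))
      (ContinuousOn.div (Continuous.continuousOn (by fun_prop))
        (Continuous.continuousOn (by fun_prop)) fun p hp => (hpos p hp).ne')
    refine ⟨_, ?_, (div_lt_one (hpos p₀ hp₀)).2 (hdom p₀ hp₀), fun p hp => ?_⟩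
    · have := hθ1 p₀ hp₀; have := hθ2 p₀ hp₀; have := hpos p₀ hp₀
      positivity
    · rw [← div_le_iff₀ (hpos p hp)]
      exact hmax hp
  have : CompactSpace Λ := isCompact_iff_compactSpace.1 hΛ
  let F : Λ ≃ₜ Λ :=
    { toFun := fun p => ⟨henon a c ha p, hf p p.2⟩
      invFun := fun p => ⟨(henon a c ha).symm p, hg p p.2⟩
      left_inv := fun p => Subtype.ext (Equiv.symm_apply_apply _ _)
      right_inv := fun p => Subtype.ext (Equiv.apply_symm_apply _ _)
      continuous_toFun :=
        ((contDiff_henon a c ha).continuous.comp continuous_subtype_val).subtype_mk _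
      continuous_invFun :=
        ((contDiff_henon_symm a c ha).continuous.comp continuous_subtype_val).subtype_mk _ }
  let ξ : C(Λ, ℂ) := ⟨fun p => p.1.1, by fun_prop⟩
  let θ' : C(Λ, ℝ) := ⟨fun p => θ p.1.1, by fun_prop⟩
  have haκ : ‖a‖ * κ ^ 2 < 1 := by nlinarith [norm_nonneg a, sq_nonneg κ]
  have hpos' : ∀ p : Λ, 0 < θ' p := fun p => hθ _ p.2
  obtain ⟨q, hq⟩ := exists_unstable_slope F ξ θ' a κ hpos' hκ0 haκ (by
    rintro ⟨p, hp⟩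
    change κ⁻¹ * θ (p.1 ^ 2 + c - a * p.2) + ‖a‖ * κ * θ p.2 ≤ 2 * ‖p.1‖ * θ p.1
    have h1 := hκ p hp
    have h2 := hθ2 p hp
    have h3 : κ ≤ κ⁻¹ := hκ1.le.trans ((one_le_inv₀ hκ0).2 hκ1.le)
    calc _ ≤ κ⁻¹ * θ (p.1 ^ 2 + c - a * p.2) + ‖a‖ * κ⁻¹ * θ p.2 := by gcongr
      _ = κ⁻¹ * (θ (p.1 ^ 2 + c - a * p.2) + ‖a‖ * θ p.2) := by ring
      _ ≤ κ⁻¹ * (κ * (2 * ‖p.1‖ * θ p.1)) := by gcongr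
      _ = _ := by field_simp)
  obtain ⟨h, hh⟩ := exists_stable_coefficient F q θ' a κ hpos' hκ0 haκ fun p => (hq p).2
  have key : ∀ p ∈ Λ, let q₀ := zeroExtend q p; let q₁ := zeroExtend q (henon a c ha p)
      let h₀ := zeroExtend h p; let h₁ := zeroExtend h (henon a c ha p)
      q₁ * (2 * p.1 - a * q₀) = 1 ∧ ‖q₁‖ * θ (henon a c ha p).1 ≤ κ * θ p.1 ∧
        h₀ = a * q₁ * (1 + q₁ * h₁) := by
    intro p hp
    simp only [zeroExtend_of_mem _ hp, zeroExtend_of_mem _ (hf p hp)]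
    exact ⟨(hq ⟨p, hp⟩).1, (hq ⟨p, hp⟩).2, hh ⟨p, hp⟩⟩
  have hqc := continuousOn_zeroExtend q
  have hhc := continuousOn_zeroExtend h
  generalize zeroExtend q = q at *
  generalize zeroExtend h = h at *
  -- The multiplier on the unstable line is `1 / q₁`. On the stable line it is `a q₁`, since the
  -- product must be the Jacobian `a`.
  have hDu : ∀ p ∈ Λ, fderiv ℂ (henon a c ha) p ((1 : ℂ), q p) =
      (2 * p.1 - a * q p) • ((1 : ℂ), q (henon a c ha p)) := by
    intro p hp
    obtain ⟨h1, -, -⟩ := key p hp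
    rw [fderiv_henon]
    ext
    · simp
    · simp only [Prod.smul_mk, smul_eq_mul]
      linear_combination -h1
  have hDs : ∀ p ∈ Λ, fderiv ℂ (henon a c ha) p (h p, 1 + h p * q p) =
      (a * q (henon a c ha p)) • (h (henon a c ha p),
        1 + h (henon a c ha p) * q (henon a c ha p)) := by
    intro p hp
    obtain ⟨h1, -, h2⟩ := key p hp
    rw [fderiv_henon]
    ext
    · simp only [Prod.smul_mk, smul_eq_mul]
      linear_combination (2 * p.1 - a * q p) * h2 +
        a * (1 + q (henon a c ha p) * h (henon a c ha p)) * h1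
    · simp only [Prod.smul_mk, smul_eq_mul]
      linear_combination h2
  have hDs' : ∀ p ∈ Λ, fderiv ℂ (henon a c ha).symm (henon a c ha p) (h (henon a c ha p),
        1 + h (henon a c ha p) * q (henon a c ha p)) =
      (a * q (henon a c ha p))⁻¹ • (h p, 1 + h p * q p) := by
    intro p hp
    obtain ⟨h1, -, h2⟩ := key p hp
    have hq0 : q (henon a c ha p) ≠ 0 := left_ne_zero_of_mul_eq_one h1
    rw [eq_inv_smul_iff₀ (mul_ne_zero ha hq0), ← map_smul, ← hDs p hp, fderiv_henon,
      fderiv_henon_symm, henon_apply]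
    ext
    · rfl
    · field_simp
      ring
  refine ⟨contDiff_henon a c ha, contDiff_henon_symm a c ha, hΛ, hinv,
    fun p => Submodule.span ℂ {(h p, 1 + h p * q p)}, fun p => Submodule.span ℂ {((1 : ℂ), q p)},
    ⟨fun p _ => isCompl_frame _ _, fun p => frameProj (q p) (h p), ?_, fun p _ => ⟨?_, ?_⟩⟩,
    fun p hp => ⟨?_, ?_⟩, κ⁻¹, fun p => frameNorm (q p) (h p) (θ p.1), (one_lt_inv₀ hκ0).2 hκ1,
    ⟨fun p hp v hv => ?_, ?_⟩, fun p hp => ⟨?_, ?_⟩⟩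
  · unfold frameProj
    fun_prop
  · intro v hv
    obtain ⟨β, rfl⟩ := Submodule.mem_span_singleton.1 hv
    exact frameProj_stable _ _ _
  · intro v hv
    obtain ⟨α, rfl⟩ := Submodule.mem_span_singleton.1 hv
    exact frameProj_unstable _ _ _
  · exact image_span_singleton (fderiv ℂ (henon a c ha) p).toLinearMap
      (mul_ne_zero ha (left_ne_zero_of_mul_eq_one (key p hp).1)) (hDs p hp)
  · exact image_span_singleton (fderiv ℂ (henon a c ha) p).toLinearMap
      (right_ne_zero_of_mul_eq_one (key p hp).1) (hDu p hp)
  · have ht : (θ p.1 : ℂ) ≠ 0 := by exact_mod_cast (hθ p hp).ne'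
    rw [frameNorm_apply] at hv
    have h1 : v.2 - q p * v.1 = 0 := by
      have : ‖(θ p.1 : ℂ) * (v.2 - q p * v.1)‖ = 0 :=
        le_antisymm (by linarith [norm_nonneg ((θ p.1 : ℂ)⁻¹ * (v.1 - h p * (v.2 - q p * v.1)))])
          (norm_nonneg _)
      exact (mul_eq_zero.1 (norm_eq_zero.1 this)).resolve_left ht
    rw [h1] at hv
    have h2 : v.1 = 0 := by simpa [ht, (hθ p hp).ne'] using hv
    rw [h2, mul_zero, sub_zero] at h1
    exact Prod.ext h2 h1
  · simp only [frameNorm_apply]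
    have e1 : ContinuousOn (fun x : (ℂ × ℂ) × (ℂ × ℂ) => q x.1) (Λ ×ˢ Set.univ) :=
      hqc.comp continuous_fst.continuousOn fun x hx => hx.1
    have e2 : ContinuousOn (fun x : (ℂ × ℂ) × (ℂ × ℂ) => h x.1) (Λ ×ˢ Set.univ) :=
      hhc.comp continuous_fst.continuousOn fun x hx => hx.1
    have e3 : ContinuousOn (fun x : (ℂ × ℂ) × (ℂ × ℂ) => (θ x.1.1 : ℂ)) (Λ ×ˢ Set.univ) :=
      Continuous.continuousOn (by fun_prop)
    have e4 : ContinuousOn (fun x : (ℂ × ℂ) × (ℂ × ℂ) => (θ x.1.1 : ℂ)⁻¹) (Λ ×ˢ Set.univ) :=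
      e3.inv₀ fun x hx => by exact_mod_cast (hθ _ hx.1).ne'
    have e5 : ContinuousOn (fun x : (ℂ × ℂ) × (ℂ × ℂ) => x.2.1) (Λ ×ˢ Set.univ) := by fun_prop
    have e6 : ContinuousOn (fun x : (ℂ × ℂ) × (ℂ × ℂ) => x.2.2) (Λ ×ˢ Set.univ) := by fun_prop
    have e7 := e6.sub (e1.mul e5)
    exact (e4.mul (e5.sub (e2.mul e7))).norm.add (e3.mul e7).norm
  · intro w hw
    obtain ⟨α, rfl⟩ := Submodule.mem_span_singleton.1 hw
    obtain ⟨h1, h2, -⟩ := key p hp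
    have ht := hθ p hp
    have ht1 := hθ _ (hf p hp)
    beta_reduce
    rw [ContinuousLinearMap.map_smul, hDu p hp, smul_smul, frameNorm_unstable _ _ ht, frameNorm_unstable _ _ ht1,
      norm_mul]
    have h3 : ‖q (henon a c ha p)‖ * ‖2 * p.1 - a * q p‖ = 1 := by rw [← norm_mul, h1, norm_one]
    have h4 : θ (henon a c ha p).1 ≤ κ * θ p.1 * ‖2 * p.1 - a * q p‖ := by
      have := mul_le_mul_of_nonneg_right h2 (norm_nonneg (2 * p.1 - a * q p))
      calc _ = ‖q (henon a c ha p)‖ * ‖2 * p.1 - a * q p‖ * θ (henon a c ha p).1 := by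
            rw [h3, one_mul]
        _ ≤ _ := by linarith
    rw [← div_eq_inv_mul, div_div, div_le_div_iff₀ (by positivity) ht1]
    calc ‖α‖ * θ (henon a c ha p).1 ≤ ‖α‖ * (κ * θ p.1 * ‖2 * p.1 - a * q p‖) := by gcongr
      _ = _ := by ring
  · intro w hw
    rw [← hinv] at hp
    obtain ⟨p, hp, rfl⟩ := hp
    obtain ⟨β, rfl⟩ := Submodule.mem_span_singleton.1 hw
    obtain ⟨h1, h2, -⟩ := key p hp
    have hq0 : q (henon a c ha p) ≠ 0 := left_ne_zero_of_mul_eq_one h1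
    have ht := hθ p hp
    have ht1 := hθ _ (hf p hp)
    beta_reduce
    rw [ContinuousLinearMap.map_smul, hDs' p hp, smul_smul, Equiv.symm_apply_apply, frameNorm_stable _ _ ht,
      frameNorm_stable _ _ ht1, norm_mul, norm_inv, norm_mul, ← div_eq_inv_mul,
      div_le_iff₀ hκ0]
    -- The stable multiplier, measured in the norm, is at most `|a| κ`; the factor `|a| < 1` is
    -- discarded to share the rate `κ⁻¹`.
    have h3 : ‖q (henon a c ha p)‖ * θ (henon a c ha p).1 * ‖a‖ ≤ κ * θ p.1 := by
      refine (mul_le_of_le_one_right ?_ ha1.le).trans h2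
      positivity
    have ha0 : 0 < ‖a‖ := norm_pos_iff.2 ha
    have hq1 : 0 < ‖q (henon a c ha p)‖ := norm_pos_iff.2 hq0
    have h4 : θ (henon a c ha p).1 ≤ κ * θ p.1 * (‖a‖ * ‖q (henon a c ha p)‖)⁻¹ := by
      rw [← div_eq_mul_inv, le_div_iff₀ (by positivity)]
      linarith
    calc ‖β‖ * θ (henon a c ha p).1 ≤ ‖β‖ * (κ * θ p.1 * (‖a‖ * ‖q (henon a c ha p)‖)⁻¹) := by
          gcongr
      _ = _ := by ring

/-! ### Filtration and localization of the Julia set -/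

/-- A region in which some coordinate grows geometrically contains no bounded orbit. -/
theorem disjoint_boundedOrbitSet_of_escape {V : Type*} [NormedAddCommGroup V] {g : V → V}
    {W : Set V} {φ : V → ℝ} {ρ : ℝ} (hρ : 1 < ρ) (hφ : ∀ p, φ p ≤ ‖p‖) (hW : ∀ p ∈ W, 0 < φ p)
    (hmaps : Set.MapsTo g W W) (hgrow : ∀ p ∈ W, ρ * φ p ≤ φ (g p)) :
    Disjoint W (boundedOrbitSet g) := by
  rw [Set.disjoint_left]
  intro p hp hb
  have h1 : ∀ n : ℕ, g^[n] p ∈ W ∧ ρ ^ n * φ p ≤ φ (g^[n] p) := by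
    intro n
    induction n with
    | zero => simp [hp]
    | succ n ih =>
      rw [Function.iterate_succ_apply']
      refine ⟨hmaps ih.1, le_trans ?_ (hgrow _ ih.1)⟩
      rw [pow_succ', mul_assoc]
      exact mul_le_mul_of_nonneg_left ih.2 (by linarith)
  obtain ⟨C, hC⟩ := isBounded_iff_forall_norm_le.1 hb
  obtain ⟨n, hn⟩ := pow_unbounded_of_one_lt (C / φ p) hρ
  rw [div_lt_iff₀ (hW p hp)] at hn
  have := hC _ ⟨n, rfl⟩
  linarith [(h1 n).2, hφ (g^[n] p)]

theorem frontier_disjoint_of_isOpen {V : Type*} [TopologicalSpace V] {W K : Set V} (hW : IsOpen W)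
    (h : Disjoint W K) : Disjoint W (frontier K) :=
  (h.closure_right hW).mono_right frontier_subset_closure

theorem preimage_boundedOrbitSet {V : Type*} [NormedAddCommGroup V] (g : V → V) :
    g ⁻¹' boundedOrbitSet g = boundedOrbitSet g := by
  ext p
  have e : Set.range (fun n : ℕ => g^[n] p) = insert p (Set.range fun n : ℕ => g^[n] (g p)) := by
    ext w
    constructor
    · rintro ⟨_ | n, rfl⟩
      · exact Or.inl rfl
      · exact Or.inr ⟨n, (Function.iterate_succ_apply g n p).symm⟩
    · rintro (rfl | ⟨n, rfl⟩)
      · exact ⟨0, rfl⟩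
      · exact ⟨n + 1, Function.iterate_succ_apply g n p⟩
  simp only [boundedOrbitSet, Set.mem_preimage, Set.mem_ofPred_eq, e, Bornology.isBounded_insert]

theorem mem_boundedOrbitSet_of_mapsTo {V : Type*} [NormedAddCommGroup V] {g : V → V} {W : Set V}
    (hW : Bornology.IsBounded W) (h : Set.MapsTo g W W) : W ⊆ boundedOrbitSet g := by
  intro p hp
  refine hW.subset ?_
  rintro _ ⟨n, rfl⟩
  exact h.iterate n hp

/-- The Julia set of a homeomorphism is invariant. -/
theorem image_juliaSet {V : Type*} [NormedAddCommGroup V] (f : V ≃ V) (hf : Continuous f)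
    (hf' : Continuous f.symm) : f '' juliaSet f = juliaSet f := by
  let F : V ≃ₜ V := ⟨f, hf, hf'⟩
  have h1 : F '' boundedOrbitSet f = boundedOrbitSet f := by
    conv_lhs => rw [← preimage_boundedOrbitSet f]
    exact Set.image_preimage_eq _ f.surjective
  have h2 : F '' boundedOrbitSet f.symm = boundedOrbitSet f.symm := by
    refine (Equiv.image_eq_preimage_symm f _).trans ?_
    exact preimage_boundedOrbitSet _
  change F '' juliaSet f = juliaSet f
  rw [juliaSet, Set.image_inter F.injective, F.image_frontier, F.image_frontier, h1, h2]

theorem disjoint_juliaSet_of_isOpen {V : Type*} [NormedAddCommGroup V] (f : V ≃ V) {U : Set V}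
    (hU : IsOpen U) (h : U ⊆ boundedOrbitSet f) : Disjoint U (juliaSet f) :=
  (disjoint_interior_frontier.mono_left (interior_maximal h hU)).mono_right Set.inter_subset_left

section Henon

variable {a c : ℂ} (ha : a ≠ 0) {R : ℝ}

theorem henon_mem_juliaSet {p : ℂ × ℂ} (hp : p ∈ juliaSet (henon a c ha)) :
    (p.1 ^ 2 + c - a * p.2, p.1) ∈ juliaSet (henon a c ha) := by
  rw [← image_juliaSet _ (contDiff_henon a c ha).continuous (contDiff_henon_symm a c ha).continuous]
  exact ⟨p, hp, rfl⟩

theorem henon_symm_mem_juliaSet {p : ℂ × ℂ} (hp : p ∈ juliaSet (henon a c ha)) :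
    (p.2, (p.2 ^ 2 + c - p.1) / a) ∈ juliaSet (henon a c ha) := by
  rw [← image_juliaSet _ (contDiff_henon a c ha).continuous
    (contDiff_henon_symm a c ha).continuous] at hp
  obtain ⟨p, hp, rfl⟩ := hp
  rw [← henon_symm_apply a c ha, Equiv.symm_apply_apply]
  exact hp

/-- The escape estimate behind the filtration of a Hénon map. -/
theorem exists_escape_rate (hR : 0 < R) (ha1 : ‖a‖ ≤ 1) (hRac : (1 + ‖a‖) * R + ‖c‖ < R ^ 2) :
    ∃ ρ : ℝ, 1 < ρ ∧ ∀ t : ℝ, R ≤ t →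
      ρ * t ≤ t ^ 2 - ‖c‖ - ‖a‖ * t ∧ ρ * (‖a‖ * t) ≤ t ^ 2 - ‖c‖ - t := by
  -- This `ρ` gives equality in the first estimate at `t = R`. The second follows from the first and
  -- `(ρ - 1)(1 - |a|) t ≥ 0`.
  refine ⟨(R ^ 2 - ‖c‖ - ‖a‖ * R) / R, ?_, fun t ht => ?_⟩
  · rw [one_lt_div hR]
    linarith
  · set ρ := (R ^ 2 - ‖c‖ - ‖a‖ * R) / R with hρ
    have h1 : ρ * R = R ^ 2 - ‖c‖ - ‖a‖ * R := div_mul_cancel₀ _ hR.ne'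
    have h2 : 1 < ρ := by
      rw [hρ, one_lt_div hR]
      linarith
    have h3 : 0 ≤ R - ρ - ‖a‖ := by
      by_contra! h
      nlinarith [norm_nonneg c]
    have h4 : ρ * t ≤ t ^ 2 - ‖c‖ - ‖a‖ * t := by
      nlinarith [mul_le_mul ht (by linarith : R - ρ - ‖a‖ ≤ t - ρ - ‖a‖) h3 (hR.le.trans ht)]
    refine ⟨h4, ?_⟩
    nlinarith [mul_nonneg (mul_nonneg (sub_nonneg.2 h2.le) (sub_nonneg.2 ha1)) (hR.le.trans ht)]

theorem le_norm_henon_fst (p : ℂ × ℂ) :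
    ‖p.1‖ ^ 2 - ‖c‖ - ‖a‖ * ‖p.2‖ ≤ ‖p.1 ^ 2 + c - a * p.2‖ := by
  have h : p.1 ^ 2 = (p.1 ^ 2 + c - a * p.2) - c + a * p.2 := by ring
  have h1 := norm_add_le ((p.1 ^ 2 + c - a * p.2) - c) (a * p.2)
  have h2 := norm_sub_le (p.1 ^ 2 + c - a * p.2) c
  rw [← h, norm_pow, norm_mul] at h1
  linarith

/-- The Julia set of a Hénon map lies in a bidisk. -/
theorem norm_le_of_mem_juliaSet (hR : 0 < R) (ha1 : ‖a‖ ≤ 1)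
    (hRac : (1 + ‖a‖) * R + ‖c‖ < R ^ 2) {p : ℂ × ℂ} (hp : p ∈ juliaSet (henon a c ha)) :
    ‖p.1‖ ≤ R ∧ ‖p.2‖ ≤ R := by
  obtain ⟨ρ, hρ, hesc⟩ := exists_escape_rate hR ha1 hRac
  have hstep : ∀ p : ℂ × ℂ, R ≤ ‖p.1‖ → ‖p.2‖ ≤ ‖p.1‖ →
      ρ * ‖p.1‖ ≤ ‖p.1 ^ 2 + c - a * p.2‖ := by
    intro p h1 h2
    have := le_norm_henon_fst (a := a) (c := c) p
    have := (hesc _ h1).1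
    have := mul_le_mul_of_nonneg_left h2 (norm_nonneg a)
    linarith
  have hstep' : ∀ p : ℂ × ℂ, R ≤ ‖p.2‖ → ‖p.1‖ ≤ ‖p.2‖ →
      ρ * ‖p.2‖ ≤ ‖(p.2 ^ 2 + c - p.1) / a‖ := by
    intro p h1 h2
    have h3 := le_norm_henon_fst (a := 1) (c := c) (p.2, p.1)
    simp only [norm_one, one_mul] at h3
    have := (hesc _ h1).2
    rw [norm_div, le_div_iff₀ (norm_pos_iff.2 ha)]
    linarith
  have hgrow : ∀ t : ℝ, R < t → t < ρ * t := fun t ht => by nlinarith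
  have hplus : Disjoint {p : ℂ × ℂ | R < ‖p.1‖ ∧ ‖p.2‖ < ‖p.1‖} (juliaSet (henon a c ha)) := by
    refine (frontier_disjoint_of_isOpen ?_ (disjoint_boundedOrbitSet_of_escape
      (φ := fun p => ‖p.1‖) hρ norm_fst_le (fun p hp => hR.trans hp.1) ?_
      fun p hp => hstep p hp.1.le hp.2.le)).mono_right Set.inter_subset_left
    · exact (isOpen_lt continuous_const continuous_fst.norm).and (isOpen_lt continuous_snd.norm continuous_fst.norm)
    · intro p hp
      have h1 := hstep p hp.1.le hp.2.le
      have h2 := hgrow _ hp.1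
      exact ⟨hp.1.trans (h2.trans_le h1), h2.trans_le h1⟩
  have hminus : Disjoint {p : ℂ × ℂ | R < ‖p.2‖ ∧ ‖p.1‖ < ‖p.2‖} (juliaSet (henon a c ha)) := by
    refine (frontier_disjoint_of_isOpen ?_ (disjoint_boundedOrbitSet_of_escape
      (φ := fun p => ‖p.2‖) hρ norm_snd_le (fun p hp => hR.trans hp.1) ?_
      fun p hp => hstep' p hp.1.le hp.2.le)).mono_right Set.inter_subset_right
    · exact (isOpen_lt continuous_const continuous_snd.norm).and (isOpen_lt continuous_fst.norm continuous_snd.norm)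
    · intro p hp
      have h1 := hstep' p hp.1.le hp.2.le
      have h2 := hgrow _ hp.1
      exact ⟨hp.1.trans (h2.trans_le h1), h2.trans_le h1⟩
  have hle : ∀ p ∈ juliaSet (henon a c ha), R < ‖p.1‖ → ‖p.1‖ ≤ ‖p.2‖ := fun p hp h =>
    not_lt.1 fun h' => Set.disjoint_left.1 hplus ⟨h, h'⟩ hp
  have hle' : ∀ p ∈ juliaSet (henon a c ha), R < ‖p.2‖ → ‖p.2‖ ≤ ‖p.1‖ := fun p hp h =>
    not_lt.1 fun h' => Set.disjoint_left.1 hminus ⟨h, h'⟩ hp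
  -- The open escape regions omit the diagonal `|x| = |y| > R`. The image of a diagonal point has
  -- strictly larger first coordinate, so it lies in the forward escape region.
  have hfst : ‖p.1‖ ≤ R := by
    by_contra! h
    have h1 := hle p hp h
    have h2 := hle' p hp (h.trans_le h1)
    have h3 := (hgrow _ h).trans_le (hstep p h.le h2)
    exact absurd (hle _ (henon_mem_juliaSet ha hp) (h.trans h3)) (not_le.2 h3)
  exact ⟨hfst, not_lt.1 fun h => absurd (h.trans_le (hle' p hp h)) (not_lt.2 hfst)⟩

theorem isCompact_juliaSet_henon (hR : 0 < R) (ha1 : ‖a‖ ≤ 1)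
    (hRac : (1 + ‖a‖) * R + ‖c‖ < R ^ 2) : IsCompact (juliaSet (henon a c ha)) := by
  refine Metric.isCompact_of_isClosed_isBounded (isClosed_frontier.inter isClosed_frontier) ?_
  refine isBounded_iff_forall_norm_le.2 ⟨R, fun p hp => ?_⟩
  have := norm_le_of_mem_juliaSet ha hR ha1 hRac hp
  exact max_le this.1 this.2

theorem henonIsHyperbolic_of_dominance (hR : 0 < R) (ha1 : ‖a‖ < 1)
    (hRac : (1 + ‖a‖) * R + ‖c‖ < R ^ 2) (θ : ℂ → ℝ) (hθc : Continuous θ)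
    (hθ : ∀ p ∈ juliaSet (henon a c ha), 0 < θ p.1)
    (hdom : ∀ p ∈ juliaSet (henon a c ha),
      θ (p.1 ^ 2 + c - a * p.2) + ‖a‖ * θ p.2 < 2 * ‖p.1‖ * θ p.1) :
    HenonIsHyperbolic a c :=
  ⟨ha, isHyperbolicSet_henon ha ha1 (isCompact_juliaSet_henon ha hR ha1.le hRac)
    (image_juliaSet _ (contDiff_henon a c ha).continuous (contDiff_henon_symm a c ha).continuous)
    θ hθc hθ hdom⟩

end Henon

/-! ### The two maps with constant weight -/

theorem henonIsHyperbolic_neg_22 : HenonIsHyperbolic (a := -0.22) (c := 0) := by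
  have ha : (-0.22 : ℂ) ≠ 0 := by norm_num
  have hna : ‖(-0.22 : ℂ)‖ = 0.22 := by norm_num
  -- Here and in the other three cases the radius is slightly above the positive root of `R² = (1 +
  -- |a|) R + |c|`.
  have hR : (1 + ‖(-0.22 : ℂ)‖) * 1.23 + ‖(0 : ℂ)‖ < (1.23 : ℝ) ^ 2 := by
    rw [hna, norm_zero]; norm_num
  have hbox := fun p => norm_le_of_mem_juliaSet (p := p) ha (by norm_num)
    (by rw [hna]; norm_num) hR
  let U : Set (ℂ × ℂ) := {p | ‖p.1‖ < 0.775 ∧ ‖p.2‖ < 0.775}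
  have hstep : ∀ p : ℂ × ℂ, ‖p.1 ^ 2 + 0 - (-0.22) * p.2‖ ≤ ‖p.1‖ ^ 2 + 0.22 * ‖p.2‖ := by
    intro p
    rw [add_zero, ← hna, ← norm_pow, ← norm_mul]
    exact norm_sub_le _ _
  have hU : Disjoint U (juliaSet (henon (-0.22) 0 ha)) := by
    refine disjoint_juliaSet_of_isOpen _ ?_ (mem_boundedOrbitSet_of_mapsTo ?_ ?_)
    · exact (isOpen_lt continuous_fst.norm continuous_const).and
        (isOpen_lt continuous_snd.norm continuous_const)
    · exact isBounded_iff_forall_norm_le.2 ⟨0.775, fun p hp => max_le hp.1.le hp.2.le⟩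
    · intro p hp
      have h1 : ‖p.1‖ < 0.775 := hp.1
      have h2 : ‖p.2‖ < 0.775 := hp.2
      refine ⟨?_, h1⟩
      refine (hstep p).trans_lt ?_
      nlinarith [norm_nonneg p.1]
  refine henonIsHyperbolic_of_dominance ha (by norm_num) (by rw [hna]; norm_num) hR (fun _ => 1)
    continuous_const (fun _ _ => one_pos) fun p hp => ?_
  -- Dominance with `θ = 1` needs only `|x| > 0.61`. A point of the box with `|x| < 0.71` enters the
  -- forward invariant bidisk `U` after one step.
  have h : 0.71 ≤ ‖p.1‖ := by
    by_contra! h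
    have h1 : ‖p.1 ^ 2 + 0 - (-0.22) * p.2‖ < 0.775 := by
      refine (hstep p).trans_lt ?_
      nlinarith [norm_nonneg p.1, (hbox p hp).2]
    have h2 : ‖p.1‖ < 0.775 := by linarith
    exact Set.disjoint_left.1 hU ⟨h1, h2⟩ (henon_mem_juliaSet ha hp)
  rw [hna]
  linarith

theorem henonIsHyperbolic_one_tenth : HenonIsHyperbolic (a := 0.1) (c := -0.3) := by
  have ha : (0.1 : ℂ) ≠ 0 := by norm_num
  have hna : ‖(0.1 : ℂ)‖ = 0.1 := by norm_num
  have hnc : ‖(-0.3 : ℂ)‖ = 0.3 := by norm_num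
  have hR : (1 + ‖(0.1 : ℂ)‖) * 1.33 + ‖(-0.3 : ℂ)‖ < (1.33 : ℝ) ^ 2 := by
    rw [hna, hnc]; norm_num
  have hbox := fun p => norm_le_of_mem_juliaSet (p := p) ha (by norm_num)
    (by rw [hna]; norm_num) hR
  -- Dominance with `θ = 1` needs `|x| > 0.55`. The estimates give `f² U ⊆ U` but bound the first
  -- coordinate on `f U` only by `0.75`, so the forward invariant set used below is `U ∪ f U`.
  let U : Set (ℂ × ℂ) := {p | ‖p.1‖ < 0.56 ∧ ‖p.2‖ < 1.34}
  let f : ℂ × ℂ → ℂ × ℂ := fun p => (p.1 ^ 2 + -0.3 - 0.1 * p.2, p.1)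
  have hw : ∀ p ∈ U, ‖(f p).1 + 0.3‖ ≤ 0.4476 := by
    intro p hp
    have h1 : ‖p.1‖ < 0.56 := hp.1
    have h2 : ‖p.2‖ < 1.34 := hp.2
    have e : (f p).1 + 0.3 = p.1 ^ 2 - 0.1 * p.2 := by simp only [f]; ring
    rw [e]
    refine (norm_sub_le _ _).trans ?_
    rw [norm_pow, norm_mul, hna]
    nlinarith [norm_nonneg p.1]
  have hf1 : ∀ p ∈ U, ‖(f p).1‖ ≤ 0.75 := by
    intro p hp
    have h1 := norm_sub_le ((f p).1 + 0.3) 0.3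
    have h2 : ‖(0.3 : ℂ)‖ = 0.3 := by norm_num
    rw [add_sub_cancel_right, h2] at h1
    linarith [hw p hp]
  -- With `w = x₁ + 0.3`, the polynomial is `(w - 0.3)² - 0.3`. Its squared modulus, for fixed `T =
  -- |w|²`, is a concave quadratic in `Re w`; completing the square leaves a bound in `T` alone.
  have hpoly : ∀ w : ℂ, ‖w‖ ≤ 0.4476 → ‖w ^ 2 - 0.6 * w - 0.21‖ ≤ 0.5 := by
    intro w hw
    refine abs_le_of_sq_le_sq' ?_ (by norm_num) |>.2
    have h1 : w.re ^ 2 + w.im ^ 2 ≤ 0.2004 := by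
      rw [← Complex.normSq_add_mul_I, Complex.re_add_im, Complex.normSq_eq_norm_sq]
      nlinarith [norm_nonneg w]
    have e : ‖w ^ 2 - 0.6 * w - 0.21‖ ^ 2 = (w.re ^ 2 - w.im ^ 2 - 0.6 * w.re - 0.21) ^ 2 +
        (2 * w.re * w.im - 0.6 * w.im) ^ 2 := by
      have : w ^ 2 - 0.6 * w - 0.21 =
          ((w.re ^ 2 - w.im ^ 2 - 0.6 * w.re - 0.21 : ℝ) : ℂ) +
            ((2 * w.re * w.im - 0.6 * w.im : ℝ) : ℂ) * Complex.I := by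
        conv_lhs => rw [← Complex.re_add_im w]
        push_cast
        linear_combination (w.im : ℂ) ^ 2 * Complex.I_sq
      rw [this, ← Complex.normSq_eq_norm_sq, Complex.normSq_add_mul_I]
    rw [e]
    set T := w.re ^ 2 + w.im ^ 2 with hT
    have hT0 : 0 ≤ T := by positivity
    have e2 : (w.re ^ 2 - w.im ^ 2 - 0.6 * w.re - 0.21) ^ 2 +
        (2 * w.re * w.im - 0.6 * w.im) ^ 2 = T ^ 2 + 0.78 * T + 0.0441 +
          w.re * (0.252 - 1.2 * T) - 0.84 * w.re ^ 2 := by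
      rw [hT]; ring
    rw [e2]
    have h3 : w.re * (0.252 - 1.2 * T) ≤ 0.84 * w.re ^ 2 + (0.252 - 1.2 * T) ^ 2 / 3.36 := by
      have := sq_nonneg (1.68 * w.re - (0.252 - 1.2 * T))
      rw [div_eq_mul_inv]
      norm_num
      nlinarith
    rw [div_eq_mul_inv] at h3
    norm_num at h3 ⊢
    nlinarith
  have hf2 : ∀ p ∈ U, ‖(f (f p)).1‖ < 0.56 := by
    intro p hp
    have e : (f (f p)).1 = (((f p).1 + 0.3) ^ 2 - 0.6 * ((f p).1 + 0.3) - 0.21) - 0.1 * p.1 := by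
      simp only [f]; ring
    rw [e]
    refine (norm_sub_le _ _).trans_lt ?_
    rw [norm_mul, hna]
    have h1 : ‖p.1‖ < 0.56 := hp.1
    linarith [hpoly _ (hw p hp)]
  have hU : Disjoint U (juliaSet (henon 0.1 (-0.3) ha)) := by
    refine disjoint_juliaSet_of_isOpen _ ?_
      (Set.subset_union_left.trans (mem_boundedOrbitSet_of_mapsTo (W := U ∪ f '' U) ?_ ?_))
    · exact (isOpen_lt continuous_fst.norm continuous_const).and
        (isOpen_lt continuous_snd.norm continuous_const)
    · refine isBounded_iff_forall_norm_le.2 ⟨1.34, ?_⟩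
      rintro p (hp | ⟨p, hp, rfl⟩)
      · exact max_le (hp.1.le.trans (by norm_num)) hp.2.le
      · exact max_le ((hf1 p hp).trans (by norm_num)) (hp.1.le.trans (by norm_num))
    · rintro p (hp | ⟨p, hp, rfl⟩)
      · exact Or.inr ⟨p, hp, rfl⟩
      · exact Or.inl ⟨hf2 p hp, (hf1 p hp).trans_lt (by norm_num)⟩
  refine henonIsHyperbolic_of_dominance ha (by norm_num) (by rw [hna]; norm_num) hR (fun _ => 1)
    continuous_const (fun _ _ => one_pos) fun p hp => ?_
  have h : 0.56 ≤ ‖p.1‖ := by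
    by_contra! h
    exact Set.disjoint_left.1 hU ⟨h, (hbox p hp).2.trans_lt (by norm_num)⟩ hp
  rw [hna]
  linarith

/-! ### The two maps with variable weight -/

/-- The part of the orbit of `p = (x_n, x_{n-1})` from `x_{n-2}` to `x_{n+2}`. -/
theorem exists_orbit_segment {a c : ℂ} (ha : a ≠ 0) {p : ℂ × ℂ}
    (hp : p ∈ juliaSet (henon a c ha)) : ∃ x₁ x₂ z : ℂ, x₁ = p.1 ^ 2 + c - a * p.2 ∧
      x₂ = x₁ ^ 2 + c - a * p.1 ∧ p.1 = p.2 ^ 2 + c - a * z ∧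
      (x₁, p.1) ∈ juliaSet (henon a c ha) ∧ (x₂, x₁) ∈ juliaSet (henon a c ha) ∧
      (p.2, z) ∈ juliaSet (henon a c ha) := by
  have h1 := henon_mem_juliaSet ha hp
  have h2 := henon_mem_juliaSet ha h1
  have e : p.1 = p.2 ^ 2 + c - a * ((p.2 ^ 2 + c - p.1) / a) := by
    rw [mul_div_cancel₀ _ ha]
    ring
  exact ⟨p.1 ^ 2 + c - a * p.2, (p.1 ^ 2 + c - a * p.2) ^ 2 + c - a * p.1,
    (p.2 ^ 2 + c - p.1) / a, rfl, rfl, e, h1, h2, henon_symm_mem_juliaSet ha hp⟩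

theorem henonIsHyperbolic_neg_quarter : HenonIsHyperbolic (a := -0.25) (c := -3) := by
  have ha : (-0.25 : ℂ) ≠ 0 := by norm_num
  have hna : ‖(-0.25 : ℂ)‖ = 0.25 := by norm_num
  have hna' : ‖(0.25 : ℂ)‖ = 0.25 := by norm_num
  have hnc : ‖(-3 : ℂ)‖ = 3 := by norm_num
  have hn3 : ‖(3 : ℂ)‖ = 3 := by norm_num
  have hR : (1 + ‖(-0.25 : ℂ)‖) * 2.47 + ‖(-3 : ℂ)‖ < (2.47 : ℝ) ^ 2 := by
    rw [hna, hnc]; norm_num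
  have hbox := fun p => norm_le_of_mem_juliaSet (p := p) ha (by norm_num)
    (by rw [hna]; norm_num) hR
  have hfar : ∀ x x₁ y : ℂ, x₁ = x ^ 2 + -3 - -0.25 * y →
      3 ≤ ‖x‖ ^ 2 + ‖x₁‖ + 0.25 * ‖y‖ := by
    intro x x₁ y h
    have e : (3 : ℂ) = x ^ 2 - x₁ + 0.25 * y := by rw [h]; ring
    have h1 := norm_add_le (x ^ 2 - x₁) (0.25 * y)
    have h2 := norm_sub_le (x ^ 2) x₁
    rw [← e, hn3, norm_mul, hna'] at h1
    rw [norm_pow] at h2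
    linarith
  have hnear : ∀ x x₁ y : ℂ, x₁ = x ^ 2 + -3 - -0.25 * y →
      ‖x‖ ^ 2 ≤ 3 + ‖x₁‖ + 0.25 * ‖y‖ := by
    intro x x₁ y h
    have e : x ^ 2 = 3 + x₁ - 0.25 * y := by rw [h]; ring
    have h1 := norm_sub_le (3 + x₁) (0.25 * y)
    have h2 := norm_add_le 3 x₁
    rw [← e, norm_mul, norm_pow, hna'] at h1
    rw [hn3] at h2
    linarith
  -- If `x` is small, `hfar` requires `|x₁| + |y| / 4` to be almost `3`. But `x₁² ≈ 3 + x₂` and `y²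
  -- ≈ 3 - z / 4`, with `x₂` and `z` in the box, keep it below that.
  have hlow : ∀ p ∈ juliaSet (henon (-0.25) (-3) ha), 0.35 ≤ ‖p.1‖ := by
    intro p hp
    by_contra! h
    obtain ⟨x₁, x₂, z, e1, e2, e3, h1, h2, h3⟩ := exists_orbit_segment ha hp
    have b1 := hnear _ _ _ e2
    have b2 := hnear _ _ _ e3
    have b3 := hfar _ _ _ e1
    have b4 : ‖x₂‖ ≤ 2.47 := (hbox _ h2).1
    have b5 : ‖z‖ ≤ 2.47 := (hbox _ h3).2
    have b6 : ‖x₁‖ ≤ 2.36 := abs_le_of_sq_le_sq' (by norm_num; linarith) (by norm_num) |>.2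
    have b7 : ‖p.2‖ ≤ 2 := abs_le_of_sq_le_sq' (by norm_num; linarith) (by norm_num) |>.2
    nlinarith [norm_nonneg p.1]
  -- A weight decreasing in `|x|` turns the lower bound `hfar` on `|x₁| + |y| / 4` into an upper
  -- bound on the neighbours' weights.
  refine henonIsHyperbolic_of_dominance ha (by norm_num) (by rw [hna]; norm_num) hR
    (fun x => 3.4 - ‖x‖) (by fun_prop) (fun p hp => by linarith [(hbox p hp).1]) fun p hp => ?_
  obtain ⟨x₁, x₂, z, e1, -, -, h1, -, h3⟩ := exists_orbit_segment ha hp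
  have b1 := hfar _ _ _ e1
  have b2 : 0.35 ≤ ‖x₁‖ := hlow _ h1
  have b3 : 0.35 ≤ ‖p.2‖ := hlow _ h3
  have b4 := hlow p hp
  have b5 := (hbox p hp).1
  rw [← e1, hna]
  -- For `|x| ≥ 0.75` the neighbours' weights are bounded by `3.4 - 0.35`. For smaller `|x|`, `hfar`
  -- bounds the left side by `1.25 + |x|²`.
  rcases le_or_gt 0.75 ‖p.1‖ with h | h
  · nlinarith
  · nlinarith

/-- The real part of a square root of `w - 3/2` is at most `‖w‖ / √6`. -/
theorem six_mul_re_sq_le (z : ℂ) : 6 * z.re ^ 2 ≤ ‖z ^ 2 + 1.5‖ ^ 2 := by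
  have : z ^ 2 + 1.5 = ((z.re ^ 2 - z.im ^ 2 + 1.5 : ℝ) : ℂ) +
      ((2 * z.re * z.im : ℝ) : ℂ) * Complex.I := by
    conv_lhs => rw [← Complex.re_add_im z]
    push_cast
    linear_combination (z.im : ℂ) ^ 2 * Complex.I_sq
  rw [this, ← Complex.normSq_eq_norm_sq, Complex.normSq_add_mul_I]
  linarith [sq_nonneg (z.re ^ 2 + z.im ^ 2 - 1.5)]

theorem henonIsHyperbolic_one_half : HenonIsHyperbolic (a := 0.5) (c := 1.5) := by
  have ha : (0.5 : ℂ) ≠ 0 := by norm_num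
  have hna : ‖(0.5 : ℂ)‖ = 0.5 := by norm_num
  have hnc : ‖(1.5 : ℂ)‖ = 1.5 := by norm_num
  have hR : (1 + ‖(0.5 : ℂ)‖) * 2.19 + ‖(1.5 : ℂ)‖ < (2.19 : ℝ) ^ 2 := by
    rw [hna, hnc]; norm_num
  have hbox := fun p => norm_le_of_mem_juliaSet (p := p) ha (by norm_num)
    (by rw [hna]; norm_num) hR
  have hsum : ∀ x x₁ y : ℂ, x₁ = x ^ 2 + 1.5 - 0.5 * y → x ^ 2 + 1.5 = x₁ + 0.5 * y := by
    intro x x₁ y h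
    rw [h]; ring
  have hnorm : ∀ x y : ℂ, ‖x + 0.5 * y‖ ≤ ‖x‖ + 0.5 * ‖y‖ := by
    intro x y
    rw [← hna, ← norm_mul]
    exact norm_add_le _ _
  have hre : ∀ x y : ℂ, (x + 0.5 * y).re = x.re + 0.5 * y.re := by
    intro x y
    have : (0.5 : ℂ) = ((0.5 : ℝ) : ℂ) := by norm_num
    rw [this, Complex.add_re, Complex.re_ofReal_mul]
  have hRe : ∀ p ∈ juliaSet (henon 0.5 1.5 ha), |p.1.re| ≤ 1.35 := by
    intro p hp
    obtain ⟨x₁, x₂, z, e1, e2, e3, h1, h2, h3⟩ := exists_orbit_segment ha hp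
    have b1 := six_mul_re_sq_le p.1
    rw [hsum _ _ _ e1] at b1
    have b2 := hnorm x₁ p.2
    have b3 : ‖x₁‖ ≤ 2.19 := (hbox _ h1).1
    have b4 := (hbox _ hp).2
    have b5 := pow_le_pow_left₀ (norm_nonneg _) (b2.trans (by linarith : _ ≤ (3.285 : ℝ))) 2
    refine abs_le_of_sq_le_sq ?_ (by norm_num)
    norm_num at b5 ⊢
    linarith
  -- The real-part bound improves the radius `2.19` to `2.1`; with `2.19` the numbers in `hlow`
  -- would not close.
  have hS : ∀ p ∈ juliaSet (henon 0.5 1.5 ha), ‖p.1‖ ≤ 2.1 := by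
    intro p hp
    obtain ⟨x₁, x₂, z, e1, e2, e3, h1, h2, h3⟩ := exists_orbit_segment ha hp
    have b2 := hnorm x₁ p.2
    have b3 : ‖x₁‖ ≤ 2.19 := (hbox _ h1).1
    have b4 := (hbox _ hp).2
    have b5 := pow_le_pow_left₀ (norm_nonneg _) (b2.trans (by linarith : _ ≤ (3.285 : ℝ))) 2
    have b6 : |x₁.re| ≤ 1.35 := hRe _ h1
    have b7 : |p.2.re| ≤ 1.35 := hRe _ h3
    have b8 := hre x₁ p.2
    have e : p.1 ^ 2 = x₁ + 0.5 * p.2 - ((1.5 : ℝ) : ℂ) := by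
      rw [← hsum _ _ _ e1]; norm_num
    have b9 : ‖p.1 ^ 2‖ ^ 2 = ‖x₁ + 0.5 * p.2‖ ^ 2 - 3 * (x₁ + 0.5 * p.2).re + 2.25 := by
      rw [e, ← Complex.normSq_eq_norm_sq, ← Complex.normSq_eq_norm_sq, Complex.normSq_apply,
        Complex.normSq_apply, Complex.sub_re, Complex.sub_im, Complex.ofReal_re,
        Complex.ofReal_im]
      ring
    have b10 : ‖p.1 ^ 2‖ ^ 2 ≤ 4.41 ^ 2 := by
      rw [b9, b8]
      norm_num at b5 ⊢
      linarith [(abs_le.1 b6).1, (abs_le.1 b7).1]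
    have b11 := abs_le_of_sq_le_sq' b10 (by norm_num) |>.2
    rw [norm_pow] at b11
    exact abs_le_of_sq_le_sq' (by norm_num at b11 ⊢; linarith) (by norm_num) |>.2
  -- For small `x`, `Re (x₁ + y / 2) = Re x² + 1.5` is close to `1.5`, whereas `six_mul_re_sq_le` at
  -- `x₁` and at `y` gives at most `0.955 + 0.3125`.
  have hlow : ∀ p ∈ juliaSet (henon 0.5 1.5 ha), 0.46 ≤ ‖p.1‖ := by
    intro p hp
    by_contra! h
    obtain ⟨x₁, x₂, z, e1, e2, e3, h1, h2, h3⟩ := exists_orbit_segment ha hp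
    have b1 := six_mul_re_sq_le x₁
    have b2 := six_mul_re_sq_le p.2
    rw [hsum _ _ _ e2] at b1
    rw [hsum _ _ _ e3] at b2
    have b3 : ‖x₂‖ ≤ 2.1 := hS _ h2
    have b4 : ‖z‖ ≤ 2.1 := hS _ (henon_symm_mem_juliaSet ha h3)
    have b5 := pow_le_pow_left₀ (norm_nonneg _)
      ((hnorm x₂ p.1).trans (by linarith : _ ≤ (2.33 : ℝ))) 2
    have b6 := pow_le_pow_left₀ (norm_nonneg _)
      ((hnorm p.1 z).trans (by linarith : _ ≤ (1.51 : ℝ))) 2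
    have b7 : x₁.re ≤ 0.955 :=
      abs_le_of_sq_le_sq' (by norm_num at b5 ⊢; linarith) (by norm_num) |>.2
    have b8 : p.2.re ≤ 0.625 :=
      abs_le_of_sq_le_sq' (by norm_num at b6 ⊢; linarith) (by norm_num) |>.2
    have b9 := hre x₁ p.2
    have e : x₁ + 0.5 * p.2 = p.1 ^ 2 + ((1.5 : ℝ) : ℂ) := by
      rw [← hsum _ _ _ e1]; norm_num
    have b10 := (abs_le.1 (Complex.abs_re_le_norm (p.1 ^ 2))).1
    rw [e, Complex.add_re, Complex.ofReal_re] at b9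
    rw [norm_pow] at b10
    nlinarith [norm_nonneg p.1]
  -- As the weight is affine in `Re x`, the relation `x₁ + y / 2 = x² + 1.5` turns the left side of
  -- the dominance into `0.75 - Re x² / 2`, a function of `x` alone.
  refine henonIsHyperbolic_of_dominance ha (by norm_num) (by rw [hna]; norm_num) hR
    (fun x => 1 - 0.5 * x.re) (by fun_prop)
    (fun p hp => by linarith [(abs_le.1 (hRe p hp)).2]) fun p hp => ?_
  obtain ⟨x₁, x₂, z, e1, -, -, h1, -, h3⟩ := exists_orbit_segment ha hp
  have b1 := hlow p hp
  have b2 := hS p hp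
  have b3 := hre x₁ p.2
  have e : x₁ + 0.5 * p.2 = p.1 ^ 2 + ((1.5 : ℝ) : ℂ) := by
    rw [← hsum _ _ _ e1]; norm_num
  have b4 : p.1.re ^ 2 + p.1.im ^ 2 = ‖p.1‖ ^ 2 := by
    rw [← Complex.normSq_add_mul_I, Complex.re_add_im, Complex.normSq_eq_norm_sq]
  rw [e, Complex.add_re, Complex.ofReal_re, sq p.1, Complex.mul_re] at b3
  rw [← e1, hna]
  -- With `r = |x|`, right minus left is `(Re x - r/2)² + 2r - 0.75 r² - 0.75`; the quadratic in `r`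
  -- is positive between its roots, near `0.451` and `2.215`.
  nlinarith [sq_nonneg (p.1.re - ‖p.1‖ / 2), mul_nonneg (sub_nonneg.2 b1) (sub_nonneg.2 b2)]

theorem theorem1p3 :
    HenonIsHyperbolic (a := 0.1) (c := -0.3) ∧
    HenonIsHyperbolic (a := -0.22) (c := 0) ∧
    HenonIsHyperbolic (a := -0.25) (c := -3) ∧
    HenonIsHyperbolic (a := 0.5) (c := 1.5) :=
  ⟨henonIsHyperbolic_one_tenth, henonIsHyperbolic_neg_22, henonIsHyperbolic_neg_quarter,
    henonIsHyperbolic_one_half⟩
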